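/- All graphs are finite, simple and undirected. For a connected graph $G$ with vertices $v_1,\dots,v_n$, let $D(G)=(d_G(v_i,v_j))_{i,j}$ be its distance matrix, where $d_G(u,v)$ is the length of a shortest path between $u$ and $v$, and let the distance spectral radius $\rho(G)$ be the largest eigenvalue of $D(G)$. For $n\ge 3$, let the kite graph $K_3^{(n)}$ be the graph of order $n$ obtained from a triangle by attaching a path of length $n-3$ (by one of its end vertices) at a vertex of the triangle. Let $\mathcal{G}_{3,n}$ be the family of connected graphs of order $n$ with chromatic number exactly $3$. Then for every $n\ge 3$, $K_3^{(n)}$ is, up to isomorphism, the unique graph maximizing the distance spectral radius in $\mathcal{G}_{3,n}$: $K_3^{(n)}\in\mathcal{G}_{3,n}$, and every $G\in\mathcal{G}_{3,n}$ satisfies $\rho(G)\le\rho(K_3^{(n)})$, with equality if and only if $G\cong K_3^{(n)}$. -/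

import Mathlib

/-- The distance matrix of a finite graph, with entries `d_G(u, v)`
(meaningful for connected graphs). -/
noncomputable def distMatrix {V : Type*} (G : SimpleGraph V) : Matrix V V ℝ :=
  Matrix.of fun u v => (G.dist u v : ℝ)

/-- The distance spectral radius: the largest (real) eigenvalue of the distance matrix. -/
noncomputable def distSpectralRadius {V : Type*} [Fintype V] (G : SimpleGraph V) : ℝ :=
  sSup {μ : ℝ | Module.End.HasEigenvalue (distMatrix G).mulVecLin μ}

/-- On a non-empty vertex set the supremum is attained, so `distSpectralRadius G` is indeed the
largest eigenvalue of the distance matrix. -/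
theorem isGreatest_distSpectralRadius {V : Type*} [Fintype V] [Nonempty V] (G : SimpleGraph V) :
    IsGreatest {μ : ℝ | Module.End.HasEigenvalue (distMatrix G).mulVecLin μ}
      (distSpectralRadius G) := by
  classical
  have hD : (distMatrix G).IsHermitian := by
    ext u v
    simp [distMatrix, SimpleGraph.dist_comm]
  have hfin : {μ : ℝ | Module.End.HasEigenvalue (distMatrix G).mulVecLin μ}.Finite :=
    Module.End.finite_hasEigenvalue _
  have hne : {μ : ℝ | Module.End.HasEigenvalue (distMatrix G).mulVecLin μ}.Nonempty := by
    obtain ⟨i⟩ := ‹Nonempty V›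
    refine ⟨hD.eigenvalues i, Module.End.hasEigenvalue_of_hasEigenvector
      (x := (hD.eigenvectorBasis i).ofLp) ⟨?_, ?_⟩⟩
    · rw [Module.End.mem_eigenspace_iff]
      simpa using hD.mulVec_eigenvectorBasis i
    · intro h
      apply hD.eigenvectorBasis.orthonormal.ne_zero i
      ext j
      simpa using congrFun h j
  exact ⟨hne.csSup_mem hfin, fun _ hx => le_csSup hfin.bddAbove hx⟩

/-- The kite graph of order `n` (for `1 ≤ k ≤ n`): the vertices `0, …, k - 1` form a `k`-clique, and
the path `k - 1, k, …, n - 1` of length `n - k` is attached at its vertex `k - 1`. -/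
def kiteGraph (k n : ℕ) : SimpleGraph (Fin n) where
  Adj i j := i ≠ j ∧ ((i.val < k ∧ j.val < k) ∨ i.val + 1 = j.val ∨ j.val + 1 = i.val)
  symm := ⟨fun i j h => ⟨h.1.symm, by have := h.2; tauto⟩⟩
  loopless := ⟨fun i h => h.1 rfl⟩

/-- `G` belongs to the family of connected `k`-chromatic graphs of order `n`. -/
def IsConnectedChromatic {V : Type*} [Fintype V] (k n : ℕ) (G : SimpleGraph V) : Prop :=
  G.Connected ∧ G.chromaticNumber = k ∧ Fintype.card V = n

/-!
The distance matrix has positive off-diagonal entries, so its largest eigenvalue has an eigenvector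
`x` with positive entries. It is therefore enough to label the vertices of a non-bipartite connected
graph `G` by those of the kite in such a way that passing to the distances of the kite increases the
quadratic form `∑ u, ∑ v, x u * x v * d u v`, unless it leaves all distances unchanged.

This is proved for all positive weights `x` by induction on the order. If `G` has an odd Hamiltonian
cycle, distances in `G` are at most those in the cycle, and cutting the cycle open into a kite whose
end vertex has the largest weight increases the form. Otherwise some vertex `l` off an odd cycle
can be deleted without disconnecting the graph. Distances in `G` are at most those obtained by
attaching `l` to `G - l` as a pendant vertex at a neighbour `p`; there, `l` acts on the form of
`G - l` as additional weight at `p`, so that the induction hypothesis replaces `G - l` by a kite.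
It remains to move a vertex pendant at an arbitrary vertex `i` of a kite to its end. If `l` weighs
less than the part of the path beyond `i`, one inserts `l` into the path before `i`; otherwise one
reverses the path from `i` on.
-/

open Matrix SimpleGraph

section QuadraticForm

variable {V W : Type*} [Fintype V] [Fintype W] {x : V → ℝ} {d d' : V → V → ℕ}

/-- The quadratic form `x ↦ ∑ u, ∑ v, x u * x v * d u v` of an integer-valued distance `d`.
The distance `d` need not come from a graph on `V`, so that the distances of another graph,
transported along a bijection, can be compared on the same vertex set. -/
noncomputable def distForm (x : V → ℝ) (d : V → V → ℕ) : ℝ :=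
  ∑ u, ∑ v, x u * x v * d u v

theorem distForm_comp_equiv (e : V ≃ W) (x : W → ℝ) (d : W → W → ℕ) :
    distForm (x ∘ e) (fun u v => d (e u) (e v)) = distForm x d := by
  unfold distForm
  rw [← e.sum_comp]
  exact Finset.sum_congr rfl fun u _ => e.sum_comp fun v => x (e u) * x v * (d (e u) v : ℝ)

theorem distForm_dist (G : SimpleGraph V) (x : V → ℝ) :
    distForm x G.dist = x ⬝ᵥ distMatrix G *ᵥ x := by
  simp only [distForm, dotProduct, mulVec, distMatrix, of_apply, Finset.mul_sum]
  exact Finset.sum_congr rfl fun u _ => Finset.sum_congr rfl fun v _ => by ring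

theorem eq_or_distForm_lt_of_le (hx : ∀ v, 0 < x v) (h : ∀ u v, d u v ≤ d' u v) :
    d = d' ∨ distForm x d < distForm x d' := by
  refine or_iff_not_imp_left.mpr fun hne => ?_
  obtain ⟨a, ha⟩ := Function.ne_iff.mp hne
  obtain ⟨b, hab⟩ := Function.ne_iff.mp ha
  have hle (u v : V) : x u * x v * (d u v : ℝ) ≤ x u * x v * (d' u v : ℝ) :=
    mul_le_mul_of_nonneg_left (by exact_mod_cast h u v) (mul_pos (hx u) (hx v)).le
  refine Finset.sum_lt_sum (fun u _ => Finset.sum_le_sum fun v _ => hle u v)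
    ⟨a, Finset.mem_univ a, Finset.sum_lt_sum (fun v _ => hle a v) ⟨b, Finset.mem_univ b, ?_⟩⟩
  have hlt : (d a b : ℝ) < d' a b := by exact_mod_cast (h a b).lt_of_ne hab
  exact mul_lt_mul_of_pos_left hlt (mul_pos (hx a) (hx b))

theorem distForm_lt_of_add_le (hx : ∀ v, 0 < x v) (α β : V → ℝ)
    (h : ∀ u v, d u v + (α u * β v + β u * α v) ≤ d' u v)
    (hα : 0 < x ⬝ᵥ α) (hβ : 0 < x ⬝ᵥ β) : distForm x d < distForm x d' :=
  calc distForm x d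
      < distForm x d + ((x ⬝ᵥ α) * (x ⬝ᵥ β) + (x ⬝ᵥ β) * (x ⬝ᵥ α)) := by
        have := mul_pos hα hβ
        linarith
    _ = ∑ u, ∑ v, x u * x v * (d u v + (α u * β v + β u * α v)) := by
        simp only [distForm, dotProduct, Finset.sum_mul_sum, ← Finset.sum_add_distrib]
        exact Finset.sum_congr rfl fun u _ => Finset.sum_congr rfl fun v _ => by ring
    _ ≤ distForm x d' :=
        Finset.sum_le_sum fun u _ => Finset.sum_le_sum fun v _ =>
          mul_le_mul_of_nonneg_left (h u v) (mul_pos (hx u) (hx v)).le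

theorem distForm_lt_of_shift (hx : ∀ v, 0 < x v) (hd : ∀ u v, d u v = d v u)
    (hd' : ∀ u v, d' u v = d' v u) (A : Set V) (β : V → ℤ) (hA : A.Nonempty)
    (hβA : ∀ a ∈ A, β a = 0) (hcross : ∀ a ∈ A, ∀ b ∉ A, d a b + β b ≤ d' a b)
    (hside : ∀ a b, (a ∈ A ↔ b ∈ A) → d a b ≤ d' a b) (hβ : 0 < ∑ v, x v * β v) :
    distForm x d < distForm x d' := by
  classical
  refine distForm_lt_of_add_le hx (A.indicator 1) (fun v => β v) (fun u v => ?_) ?_ hβ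
  · have hcross' {a b : V} (ha : a ∈ A) (hb : b ∉ A) : (d a b + β b : ℝ) ≤ d' a b := by
      exact_mod_cast hcross a ha b hb
    have hside' (h : u ∈ A ↔ v ∈ A) : (d u v : ℝ) ≤ d' u v := by exact_mod_cast hside u v h
    by_cases hu : u ∈ A <;> by_cases hv : v ∈ A
    · simpa [hu, hv, hβA] using hside' (iff_of_true hu hv)
    · simpa [hu, hv, hβA] using hcross' hu hv
    · simpa [hu, hv, hβA, hd u v, hd' u v] using hcross' hv hu
    · simpa [hu, hv] using hside' (iff_of_false hu hv)
  · obtain ⟨a, ha⟩ := hA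
    refine Finset.sum_pos' (fun v _ => ?_) ⟨a, Finset.mem_univ a, by simpa [ha] using hx a⟩
    exact mul_nonneg (hx v).le (Set.indicator_nonneg (fun _ _ => zero_le_one) v)

end QuadraticForm

section Perron

open Module.End
open scoped MatrixOrder

variable {n : Type*} [Fintype n] {A : Matrix n n ℝ} {r : ℝ}

theorem posSemidef_smul_one_sub [DecidableEq n] (hA : A.IsHermitian)
    (hr : r ∈ upperBounds {μ | HasEigenvalue A.mulVecLin μ}) : (r • 1 - A).PosSemidef := by
  rw [← nonneg_iff_posSemidef, sub_nonneg, ← Algebra.algebraMap_eq_smul_one]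
  refine le_algebraMap_of_spectrum_le (fun μ hμ => hr ?_) hA
  rwa [← spectrum_toLin', ← hasEigenvalue_iff_mem_spectrum] at hμ

theorem dotProduct_mulVec_le (hA : A.IsHermitian)
    (hr : r ∈ upperBounds {μ | HasEigenvalue A.mulVecLin μ}) (x : n → ℝ) :
    x ⬝ᵥ A *ᵥ x ≤ r * (x ⬝ᵥ x) := by
  classical
  have h := (posSemidef_smul_one_sub hA hr).dotProduct_mulVec_nonneg x
  simpa [sub_mulVec, smul_mulVec, dotProduct_sub] using h

theorem mulVec_eq_smul_of_le_dotProduct_mulVec (hA : A.IsHermitian)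
    (hr : r ∈ upperBounds {μ | HasEigenvalue A.mulVecLin μ}) {x : n → ℝ}
    (hx : r * (x ⬝ᵥ x) ≤ x ⬝ᵥ A *ᵥ x) : A *ᵥ x = r • x := by
  classical
  have h : star x ⬝ᵥ (r • 1 - A) *ᵥ x = 0 := by
    simpa [sub_mulVec, smul_mulVec, dotProduct_sub, sub_eq_zero] using
      hx.antisymm (dotProduct_mulVec_le hA hr x)
  rw [(posSemidef_smul_one_sub hA hr).dotProduct_mulVec_zero_iff] at h
  simpa [sub_mulVec, smul_mulVec, sub_eq_zero, eq_comm] using h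

-- The entrywise absolute value of an eigenvector for `r` has at least the same Rayleigh quotient.
theorem exists_pos_mulVec_eq_smul (hA : A.IsHermitian) (hpos : ∀ i j, i ≠ j → 0 < A i j)
    (hr : IsGreatest {μ | HasEigenvalue A.mulVecLin μ} r) :
    ∃ x : n → ℝ, (∀ i, 0 < x i) ∧ A *ᵥ x = r • x := by
  obtain ⟨y, hy, hy0⟩ := hr.1.exists_hasEigenvector
  rw [mem_eigenspace_iff, mulVecLin_apply] at hy
  have hx : A *ᵥ |y| = r • |y| := by
    refine mulVec_eq_smul_of_le_dotProduct_mulVec hA hr.2 ?_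
    calc r * (|y| ⬝ᵥ |y|)
      _ = y ⬝ᵥ A *ᵥ y := by
        rw [hy, dotProduct_smul, smul_eq_mul]
        simp [dotProduct]
      _ ≤ |y| ⬝ᵥ A *ᵥ |y| := by
        simp only [dotProduct, mulVec, Finset.mul_sum, Pi.abs_apply]
        refine Finset.sum_le_sum fun i _ => Finset.sum_le_sum fun j _ => ?_
        obtain rfl | hij := eq_or_ne i j
        · rw [mul_left_comm, mul_left_comm |y i|, abs_mul_abs_self]
        · rw [mul_left_comm, mul_left_comm |y i|, ← abs_mul]
          exact mul_le_mul_of_nonneg_left (le_abs_self _) (hpos i j hij).le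
  refine ⟨|y|, fun i => abs_pos.mpr fun hi => hy0 (funext fun j => ?_), hx⟩
  have hsum : ∑ j, A i j * |y j| = 0 := by simpa [mulVec, dotProduct, hi] using congrFun hx i
  have hterm (j : n) (_ : j ∈ Finset.univ) : 0 ≤ A i j * |y j| := by
    obtain rfl | hij := eq_or_ne i j
    · simp [hi]
    · exact mul_nonneg (hpos i j hij).le (abs_nonneg _)
  obtain rfl | hij := eq_or_ne i j
  · exact hi
  · have := (Finset.sum_eq_zero_iff_of_nonneg hterm).mp hsum j (Finset.mem_univ j)
    simpa [(hpos i j hij).ne'] using this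

end Perron

section DistSpectralRadius

theorem isHermitian_distMatrix {V : Type*} (G : SimpleGraph V) : (distMatrix G).IsHermitian := by
  ext u v
  simp [distMatrix, dist_comm]

variable {V W : Type*} [Fintype V] [Fintype W] {G : SimpleGraph V} {H : SimpleGraph W}

theorem distForm_dist_le [Nonempty V] (G : SimpleGraph V) (x : V → ℝ) :
    distForm x G.dist ≤ distSpectralRadius G * (x ⬝ᵥ x) := by
  rw [distForm_dist]
  exact dotProduct_mulVec_le (isHermitian_distMatrix G) (isGreatest_distSpectralRadius G).2 x

theorem exists_pos_distForm_dist_eq (hG : G.Connected) :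
    ∃ x : V → ℝ, (∀ v, 0 < x v) ∧ distForm x G.dist = distSpectralRadius G * (x ⬝ᵥ x) := by
  have := hG.nonempty
  obtain ⟨x, hx, hxA⟩ := exists_pos_mulVec_eq_smul (isHermitian_distMatrix G)
    (fun u v huv => Nat.cast_pos.mpr (hG.pos_dist_of_ne huv)) (isGreatest_distSpectralRadius G)
  exact ⟨x, hx, by rw [distForm_dist, hxA, dotProduct_smul, smul_eq_mul]⟩

theorem distSpectralRadius_eq_of_dist_eq (σ : V ≃ W)
    (h : ∀ u v, G.dist u v = H.dist (σ u) (σ v)) :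
    distSpectralRadius G = distSpectralRadius H := by
  classical
  have hGH : distMatrix H = reindex σ σ (distMatrix G) := by
    ext a b
    simp [distMatrix, h]
  simp only [distSpectralRadius, Module.End.hasEigenvalue_iff_isRoot_charpoly, charpoly_mulVecLin,
    hGH, charpoly_reindex]

theorem distSpectralRadius_lt_of_distForm_lt [Nonempty W] (σ : V ≃ W) {x : V → ℝ}
    (hxG : distForm x G.dist = distSpectralRadius G * (x ⬝ᵥ x))
    (h : distForm x G.dist < distForm x fun u v => H.dist (σ u) (σ v)) :
    distSpectralRadius G < distSpectralRadius H := by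
  refine lt_of_mul_lt_mul_right ?_ (dotProduct_self_star_nonneg x)
  calc distSpectralRadius G * (x ⬝ᵥ x) = distForm x G.dist := hxG.symm
    _ < distForm x fun u v => H.dist (σ u) (σ v) := h
    _ = distForm (x ∘ σ.symm) H.dist := by
      rw [← distForm_comp_equiv σ]
      simp [Function.comp_def]
    _ ≤ distSpectralRadius H * (x ∘ σ.symm ⬝ᵥ x ∘ σ.symm) := distForm_dist_le H _
    _ = distSpectralRadius H * (x ⬝ᵥ x) := by rw [comp_equiv_dotProduct_comp_equiv]

end DistSpectralRadius

section Distance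

variable {V W : Type*} {G : SimpleGraph V} {H : SimpleGraph W}

theorem edist_map_le (f : H →g G) (a b : W) : G.edist (f a) (f b) ≤ H.edist a b := by
  by_cases h : H.edist a b = ⊤
  · exact h ▸ le_top
  · obtain ⟨p, hp⟩ := exists_walk_of_edist_ne_top h
    simpa [hp] using edist_le (p.map f)

theorem dist_map_le (hH : H.Connected) (f : H →g G) (a b : W) :
    G.dist (f a) (f b) ≤ H.dist a b :=
  ENat.toNat_le_toNat (edist_map_le f a b) (edist_ne_top_iff_reachable.mpr (hH a b))

theorem dist_map_iso (e : G ≃g H) (u v : V) : H.dist (e u) (e v) = G.dist u v := by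
  refine congrArg ENat.toNat ((edist_map_le e.toHom u v).antisymm ?_)
  simpa using edist_map_le e.symm.toHom (e u) (e v)

theorem nonempty_iso_of_dist_eq (σ : V ≃ W) (h : ∀ u v, G.dist u v = H.dist (σ u) (σ v)) :
    Nonempty (G ≃g H) :=
  ⟨⟨σ, fun {u v} => by rw [← dist_eq_one_iff_adj, ← dist_eq_one_iff_adj, h]⟩⟩

end Distance

section KiteGraph

variable {k n : ℕ}

theorem kiteGraph_connected (k : ℕ) (hn : 0 < n) : (kiteGraph k n).Connected := by
  obtain ⟨m, rfl⟩ := Nat.exists_eq_add_one.mpr hn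
  refine (pathGraph_connected m).mono fun i j h => ⟨h.ne, Or.inr ?_⟩
  simpa only [pathGraph_adj] using h

theorem natDist_max_le_length_kiteGraph {i j : Fin n} (p : (kiteGraph k n).Walk i j) :
    Nat.dist (max i (k - 2)) (max j (k - 2)) ≤ p.length := by
  induction p with
  | nil => simp
  | @cons u v w h p ih =>
    have huv : Nat.dist (max u (k - 2)) (max v (k - 2)) ≤ 1 := by
      have := h.2
      simp only [Nat.dist]
      omega
    rw [Walk.length_cons, add_comm]
    exact (Nat.dist.triangle_inequality _ _ _).trans (add_le_add huv ih)

theorem kiteGraph_dist_le_of_lt {i j : Fin n} (hij : i < j) :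
    (kiteGraph k n).dist i j ≤ max 1 (Nat.dist (max i (k - 2)) (max j (k - 2))) := by
  obtain ⟨j, hj⟩ := j
  induction j with
  | zero => exact absurd hij (Nat.not_lt_zero i)
  | succ j ih =>
    replace hij : (i : ℕ) < j + 1 := hij
    by_cases hadj : (kiteGraph k n).Adj i ⟨j + 1, hj⟩
    · rw [dist_eq_one_iff_adj.mpr hadj]
      exact le_max_left ..
    · have hfar : (i : ℕ) < j ∧ k ≤ j + 1 := by
        simp only [kiteGraph, ne_eq, Fin.ext_iff] at hadj
        omega
      have hlast : (kiteGraph k n).Adj ⟨j, by omega⟩ ⟨j + 1, hj⟩ :=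
        ⟨by simp, Or.inr (Or.inl rfl)⟩
      have htriangle := (kiteGraph_connected k (by omega)).dist_triangle
        (u := i) (v := ⟨j, by omega⟩) (w := ⟨j + 1, hj⟩)
      have hprev := ih (by omega) hfar.1
      rw [dist_eq_one_iff_adj.mpr hlast] at htriangle
      simp only [Nat.dist] at hprev ⊢
      omega

theorem kiteGraph_dist (i j : Fin n) :
    (kiteGraph k n).dist i j =
      if i = j then 0 else max 1 (Nat.dist (max i (k - 2)) (max j (k - 2))) := by
  have hconn : (kiteGraph k n).Connected := kiteGraph_connected k i.pos
  split_ifs with hij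
  · rw [hij, dist_self]
  · refine le_antisymm ?_ (max_le (hconn.pos_dist_of_ne hij) ?_)
    · obtain hlt | hlt := lt_or_gt_of_ne hij
      · exact kiteGraph_dist_le_of_lt hlt
      · rw [dist_comm, Nat.dist_comm]
        exact kiteGraph_dist_le_of_lt hlt
    · obtain ⟨p, hp⟩ := hconn.exists_walk_length_eq_dist i j
      exact hp ▸ natDist_max_le_length_kiteGraph p

theorem kiteGraph_chromaticNumber (hk : 2 ≤ k) (hkn : k ≤ n) :
    (kiteGraph k n).chromaticNumber = k := by
  refine le_antisymm ?_ ?_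
  · refine Colorable.chromaticNumber_le ⟨Coloring.mk (fun i : Fin n =>
      (⟨if (i : ℕ) < k then i else (i - k) % 2, ?_⟩ : Fin k)) fun {i j} h => ?_⟩
    · grind
    · have := h.1
      have := h.2
      simp only [ne_eq, Fin.ext_iff] at *
      grind
  · refine le_chromaticNumber_of_pairwise_adj (by simp) (Fin.castLE hkn) fun i j hij => ?_
    exact ⟨(Fin.castLE_injective hkn).ne hij, Or.inl ⟨i.isLt, j.isLt⟩⟩

end KiteGraph

section PendantDist

variable {U V W : Type*}

/-- The distance on `Option W` obtained from a distance `D` on `W` by attaching the new vertex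
`none` to `p` by a pendant edge. -/
def pendantDist (D : W → W → ℕ) (p : W) : Option W → Option W → ℕ
  | none, none => 0
  | none, some b => D p b + 1
  | some a, none => D a p + 1
  | some a, some b => D a b

theorem pendantDist_comm {D : W → W → ℕ} (hD : ∀ a b, D a b = D b a) (p : W) :
    ∀ u v, pendantDist D p u v = pendantDist D p v u
  | none, none => rfl
  | none, some _ => congrArg (· + 1) (hD ..)
  | some _, none => congrArg (· + 1) (hD ..)
  | some _, some _ => hD ..

theorem pendantDist_optionCongr (e : U ≃ W) (D : W → W → ℕ) (p : U) :
    ∀ u v, pendantDist D (e p) (e.optionCongr u) (e.optionCongr v) =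
      pendantDist (fun a b => D (e a) (e b)) p u v
  | none, none => rfl
  | none, some _ => rfl
  | some _, none => rfl
  | some _, some _ => rfl

-- In the quadratic form the new vertex acts like an additional weight at `p`.
theorem distForm_pendantDist [Fintype W] [DecidableEq W] (x : Option W → ℝ) {D : W → W → ℕ}
    {p : W} (hD : D p p = 0) :
    distForm x (pendantDist D p) =
      distForm (x ∘ some + Pi.single p (x none)) D + 2 * x none * ∑ a, x (some a) := by
  have expand : distForm (x ∘ some + Pi.single p (x none)) D =
      ∑ a, ∑ b, x (some a) * x (some b) * D a b + ∑ b, x none * x (some b) * D p b +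
        ∑ a, x (some a) * x none * D a p := by
    simp only [distForm, Pi.add_apply, Function.comp_apply, add_mul, mul_add,
      Finset.sum_add_distrib]
    simp [Pi.single_apply, hD]
  rw [expand]
  simp only [distForm, Fintype.sum_option, pendantDist, Nat.cast_add, Nat.cast_one, Nat.cast_zero,
    mul_add, mul_one, mul_zero, zero_add, Finset.sum_add_distrib, ← Finset.mul_sum,
    ← Finset.sum_mul]
  ring

theorem dist_le_pendantDist {G : SimpleGraph V} {H : SimpleGraph W} (hG : G.Connected)
    (hH : H.Connected) (f : H →g G) {l : V} {p : W} (hp : G.Adj l (f p)) :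
    ∀ u v : Option W, G.dist (u.elim l f) (v.elim l f) ≤ pendantDist H.dist p u v := by
  have hlp : ∀ a, G.dist l (f a) ≤ H.dist p a + 1 := fun a => by
    have htriangle := hG.dist_triangle (u := l) (v := f p) (w := f a)
    have hmap := dist_map_le hH f p a
    rw [dist_eq_one_iff_adj.mpr hp] at htriangle
    omega
  rintro (_ | a) (_ | b)
  · simp [pendantDist]
  · exact hlp b
  · simpa [pendantDist, dist_comm] using hlp a
  · exact dist_map_le hH f a b

end PendantDist

section IsKiteDominated

variable {U V : Type*} [Fintype U] [Fintype V] {n : ℕ} {x : V → ℝ} {d d' : V → V → ℕ}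

/-- The distance `d` is dominated by that of the kite `K_3^{(n)}` with respect to the weights `x`:
for a suitable labelling by the vertices of the kite, either `d` is the distance of the kite or its
quadratic form is strictly smaller at `x`. -/
def IsKiteDominated (n : ℕ) (x : V → ℝ) (d : V → V → ℕ) : Prop :=
  ∃ σ : V ≃ Fin n, (d = fun u v => (kiteGraph 3 n).dist (σ u) (σ v)) ∨
    distForm x d < distForm x fun u v => (kiteGraph 3 n).dist (σ u) (σ v)

theorem IsKiteDominated.mono (h : IsKiteDominated n x d')
    (hd : d = d' ∨ distForm x d < distForm x d') : IsKiteDominated n x d := by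
  obtain ⟨σ, hσ⟩ := h
  obtain rfl | hlt := hd
  · exact ⟨σ, hσ⟩
  · exact ⟨σ, Or.inr (hσ.elim (fun h => h ▸ hlt) hlt.trans)⟩

theorem IsKiteDominated.of_equiv (e : U ≃ V)
    (h : IsKiteDominated n (x ∘ e) fun a b => d (e a) (e b)) : IsKiteDominated n x d := by
  obtain ⟨σ, hσ⟩ := h
  refine ⟨e.symm.trans σ, hσ.imp (fun hσ => ?_) fun hσ => ?_⟩
  · funext u v
    simpa using congrFun₂ hσ (e.symm u) (e.symm v)
  · rw [← distForm_comp_equiv e, ← distForm_comp_equiv e x]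
    simpa using hσ

end IsKiteDominated

theorem exists_iso_apply_eq_of_twins {V : Type*} {G : SimpleGraph V} {u v : V}
    (h : ∀ w, w ≠ u → w ≠ v → (G.Adj u w ↔ G.Adj v w)) : ∃ e : G ≃g G, e u = v := by
  classical
  refine ⟨⟨Equiv.swap u v, fun {a b} => ?_⟩, Equiv.swap_apply_left u v⟩
  have := G.adj_comm
  simp only [Equiv.swap_apply_def]
  split_ifs <;> grind [SimpleGraph.irrefl]

section PendantKite

variable {m : ℕ} {x : Option (Fin m) → ℝ}

theorem isKiteDominated_pendantDist_of_last (hm : 3 ≤ m) {i : Fin m} (hi : (i : ℕ) + 1 = m) :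
    IsKiteDominated (m + 1) x (pendantDist (kiteGraph 3 m).dist i) := by
  refine ⟨finSuccEquivLast.symm, Or.inl ?_⟩
  funext u v
  rcases u with _ | a <;> rcases v with _ | b <;>
    simp only [pendantDist, kiteGraph_dist, Nat.dist, finSuccEquivLast_symm_none, Fin.val_last,
      finSuccEquivLast_symm_some, Fin.ext_iff, Fin.val_castSucc] <;>
    grind

theorem isKiteDominated_pendantDist_of_iso (hx : ∀ v, 0 < x v) {i : Fin m}
    (e : kiteGraph 3 m ≃g kiteGraph 3 m)
    (h : ∀ y : Option (Fin m) → ℝ, (∀ v, 0 < y v) →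
      IsKiteDominated (m + 1) y (pendantDist (kiteGraph 3 m).dist i)) :
    IsKiteDominated (m + 1) x (pendantDist (kiteGraph 3 m).dist (e i)) := by
  refine .of_equiv (Equiv.optionCongr e.toEquiv) ?_
  convert h (x ∘ Equiv.optionCongr e.toEquiv) fun v => hx _ using 3 with u v
  exact (pendantDist_optionCongr e.toEquiv ..).trans (by simp [dist_map_iso])

-- Moving the new vertex into the path just before `i` pushes the vertices beyond `i` one step away
-- from those before `i`, and only the new vertex itself comes one step closer to them.
theorem isKiteDominated_pendantDist_of_insert (hx : ∀ v, 0 < x v) {i : Fin m} (hi : 0 < (i : ℕ))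
    (hS : x none < ∑ a, if i < a then x (some a) else 0) :
    IsKiteDominated (m + 1) x (pendantDist (kiteGraph 3 m).dist i) := by
  let σ : Option (Fin m) ≃ Fin (m + 1) := (finSuccEquiv' i.castSucc).symm
  have hσ_none : (σ none : ℕ) = i := by simp [σ]
  have hσ_some (a : Fin m) : (σ (some a) : ℕ) = if (a : ℕ) < i then (a : ℕ) else a + 1 := by
    simp only [σ, finSuccEquiv'_symm_some, Fin.succAbove, Fin.lt_def, Fin.val_castSucc]
    split_ifs <;> rfl
  refine ⟨σ, Or.inr (distForm_lt_of_shift hx (pendantDist_comm (fun _ _ => dist_comm) i)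
    (fun _ _ => dist_comm) {v | v.elim False (· < i)}
    (fun v => v.elim (-1) fun a => if i < a then 1 else 0) ⟨some ⟨0, i.pos⟩, hi⟩ ?_ ?_ ?_ ?_)⟩
  · rintro (_ | a) ha
    · exact ha.elim
    · exact if_neg (Fin.lt_def.mp ha).not_gt
  · rintro (_ | a) ha (_ | b) hb <;>
      simp only [Set.mem_ofPred_eq, Option.elim, Fin.lt_def, pendantDist, kiteGraph_dist, Nat.dist,
        Fin.ext_iff, hσ_none, hσ_some] at ha hb ⊢ <;>
      grind
  · rintro (_ | a) (_ | b) hab <;>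
      simp only [Set.mem_ofPred_eq, Option.elim, Fin.lt_def, pendantDist, kiteGraph_dist, Nat.dist,
        Fin.ext_iff, hσ_none, hσ_some] at hab ⊢ <;>
      grind
  · simpa [Fintype.sum_option] using hS

/-- The permutation of `Fin m` that fixes the elements below `i` and reverses the order of the
others. -/
def revFrom (i : Fin m) : Equiv.Perm (Fin m) :=
  Function.Involutive.toPerm
    (fun a => if h : a < i then a else ⟨i + (m - 1 - a), by omega⟩) fun a => by
      simp only [Fin.ext_iff, Fin.lt_def]
      grind

theorem val_revFrom (i a : Fin m) :
    (revFrom i a : ℕ) = if (a : ℕ) < i then (a : ℕ) else i + (m - 1 - a) := by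
  simp only [revFrom, Function.Involutive.coe_toPerm, Fin.lt_def]
  split_ifs <;> rfl

-- Reattaching the part of the path from `i` on by its other end moves `i` and the new vertex
-- `K` steps away from the triangle, and brings no other vertex closer to it by more than `K`.
theorem isKiteDominated_pendantDist_of_reverse (hx : ∀ v, 0 < x v) (hm : 4 ≤ m) {i : Fin m}
    (hi : 0 < (i : ℕ)) (him : (i : ℕ) + 1 < m)
    (hS : (∑ a, if i < a then x (some a) else 0) ≤ x none) :
    IsKiteDominated (m + 1) x (pendantDist (kiteGraph 3 m).dist i) := by
  let σ : Option (Fin m) ≃ Fin (m + 1) := (revFrom i).optionCongr.trans finSuccEquivLast.symm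
  have hσ_none : (σ none : ℕ) = m := by simp [σ]
  have hσ_some (a : Fin m) :
      (σ (some a) : ℕ) = if (a : ℕ) < i then (a : ℕ) else i + (m - 1 - a) := by
    simp [σ, val_revFrom]
  let K : ℤ := m - 1 - max (i : ℤ) 2
  refine ⟨σ, Or.inr (distForm_lt_of_shift hx (pendantDist_comm (fun _ _ => dist_comm) i)
    (fun _ _ => dist_comm) {v | v.elim False (· < i)}
    (fun v => v.elim K fun a => (if a = i then K else 0) - if i < a then K else 0)
    ⟨some ⟨0, i.pos⟩, hi⟩ ?_ ?_ ?_ ?_)⟩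
  · rintro (_ | a) ha
    · exact ha.elim
    · have ha : a < i := ha
      simp [ha.ne, ha.not_gt]
  · rintro (_ | a) ha (_ | b) hb <;>
      simp only [Set.mem_ofPred_eq, Option.elim, Fin.lt_def, pendantDist, kiteGraph_dist, Nat.dist,
        Fin.ext_iff, hσ_none, hσ_some, K] at ha hb ⊢ <;>
      grind
  · rintro (_ | a) (_ | b) hab <;>
      simp only [Set.mem_ofPred_eq, Option.elim, Fin.lt_def, pendantDist, kiteGraph_dist, Nat.dist,
        Fin.ext_iff, hσ_none, hσ_some] at hab ⊢ <;>
      split_ifs <;> omega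
  · have hK : 0 < K := by omega
    calc (0 : ℝ)
      _ < (x none - (∑ a, if i < a then x (some a) else 0) + x (some i)) * K := by
        have := hx (some i)
        have : (0 : ℝ) < K := by exact_mod_cast hK
        apply mul_pos <;> linarith
      _ = _ := by
        simp [Fintype.sum_option, mul_sub, add_mul, sub_mul, Finset.sum_sub_distrib, Finset.sum_mul]
        ring

theorem isKiteDominated_pendantDist_kite (hx : ∀ v, 0 < x v) (hm : 3 ≤ m) (i : Fin m) :
    IsKiteDominated (m + 1) x (pendantDist (kiteGraph 3 m).dist i) := by
  have interior (i : Fin m) (hi : 0 < (i : ℕ)) (him : (i : ℕ) + 1 < m) (hm : 4 ≤ m)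
      (y : Option (Fin m) → ℝ) (hy : ∀ v, 0 < y v) :
      IsKiteDominated (m + 1) y (pendantDist (kiteGraph 3 m).dist i) :=
    (lt_or_ge (y none) _).elim (isKiteDominated_pendantDist_of_insert hy hi)
      (isKiteDominated_pendantDist_of_reverse hy hm hi him)
  obtain rfl | hm := hm.eq_or_lt
  · obtain ⟨e, rfl⟩ : ∃ e : kiteGraph 3 3 ≃g kiteGraph 3 3, e 2 = i :=
      exists_iso_apply_eq_of_twins fun w => by
          simp only [kiteGraph, ne_eq, Fin.ext_iff]
          omega
    exact isKiteDominated_pendantDist_of_iso hx e fun y _ =>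
      isKiteDominated_pendantDist_of_last le_rfl rfl
  · obtain him | him := (Nat.succ_le_of_lt i.isLt).eq_or_lt
    · exact isKiteDominated_pendantDist_of_last hm.le him
    obtain hi | hi := (i : ℕ).eq_zero_or_pos
    · obtain ⟨e, he⟩ : ∃ e : kiteGraph 3 m ≃g kiteGraph 3 m, e ⟨1, by omega⟩ = i := by
        refine exists_iso_apply_eq_of_twins fun w => ?_
        simp only [kiteGraph, ne_eq, Fin.ext_iff]
        omega
      exact he ▸ isKiteDominated_pendantDist_of_iso hx e
        (interior ⟨1, by omega⟩ one_pos (by simp only; omega) hm)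
    · exact interior i hi him hm x hx

theorem IsKiteDominated.pendant {W : Type*} [Fintype W] [DecidableEq W] {x : Option W → ℝ}
    {D : W → W → ℕ} {p : W} (hx : ∀ v, 0 < x v) (hm : 3 ≤ m) (hD : D p p = 0)
    (h : IsKiteDominated m (x ∘ some + Pi.single p (x none)) D) :
    IsKiteDominated (m + 1) x (pendantDist D p) := by
  obtain ⟨σ, hσ⟩ := h
  let D' : W → W → ℕ := fun a b => (kiteGraph 3 m).dist (σ a) (σ b)
  have hD' : D' p p = 0 := dist_self
  refine .mono (d' := pendantDist D' p) ?_ (hσ.imp (congrArg (pendantDist · p)) fun hlt => ?_)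
  · refine .of_equiv σ.symm.optionCongr ?_
    convert isKiteDominated_pendantDist_kite (x := x ∘ σ.symm.optionCongr) (fun v => hx _) hm (σ p)
      using 3 with u v
    simpa [D'] using pendantDist_optionCongr σ.symm D' (σ p) u v
  · rw [distForm_pendantDist x hD, distForm_pendantDist x hD']
    gcongr

end PendantKite

section OddCycle

variable {n k : ℕ}

theorem dist_cycleGraph_le_sub {i j : Fin n} (hij : i ≤ j) :
    (cycleGraph n).dist i j ≤ j - i := by
  obtain ⟨m, rfl⟩ := Nat.exists_eq_add_one.mpr i.pos
  obtain ⟨l, hl, rfl⟩ : ∃ l, ∃ hl : i + l < m + 1, j = ⟨i + l, hl⟩ :=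
    ⟨j - i, by omega, Fin.ext (by simp only; omega)⟩
  simp only [add_tsub_cancel_left]
  clear hij
  induction l with
  | zero => simp
  | succ l ih =>
    have hadj : (cycleGraph (m + 1)).Adj ⟨i + l, by omega⟩ ⟨i + (l + 1), hl⟩ :=
      pathGraph_le_cycleGraph (pathGraph_adj.mpr (Or.inl rfl))
    exact cycleGraph_connected.dist_triangle.trans
      (add_le_add (ih (by omega)) (dist_eq_one_iff_adj.mpr hadj).le)

theorem dist_cycleGraph_zero_last_le (m : ℕ) : (cycleGraph (m + 1)).dist 0 (Fin.last m) ≤ 1 := by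
  obtain rfl | hm := m.eq_zero_or_pos
  · simp
  · exact (dist_eq_one_iff_adj.mpr (cycleGraph_adj'.mpr (Or.inl (by simpa using hm)))).le

theorem dist_cycleGraph_le (i j : Fin n) :
    (cycleGraph n).dist i j ≤ min (Nat.dist i j) (n - Nat.dist i j) := by
  obtain ⟨m, rfl⟩ := Nat.exists_eq_add_one.mpr i.pos
  wlog hij : i ≤ j generalizing i j
  · rw [dist_comm, Nat.dist_comm]
    exact this j i (le_of_not_ge hij)
  have inner := dist_cycleGraph_le_sub hij
  have outer := calc (cycleGraph (m + 1)).dist i j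
      _ ≤ (cycleGraph (m + 1)).dist i 0 +
          ((cycleGraph (m + 1)).dist 0 (Fin.last m) + (cycleGraph (m + 1)).dist (Fin.last m) j) :=
        cycleGraph_connected.dist_triangle.trans
          (Nat.add_le_add_left cycleGraph_connected.dist_triangle _)
      _ ≤ (i - 0) + (1 + (m - j)) := by
        rw [dist_comm (u := i), dist_comm (v := j)]
        gcongr
        · exact dist_cycleGraph_le_sub (Fin.zero_le i)
        · exact dist_cycleGraph_zero_last_le m
        · exact dist_cycleGraph_le_sub (Fin.le_last j)
  simp only [Nat.dist]
  omega

-- In the kite the vertex `0` is one step closer to `2, …, k` than in the cycle, but `2 * (k - 1)`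
-- steps farther from the last vertex, which outweighs this if that vertex has the largest weight.
theorem distForm_cycleGraph_lt (hk : 2 ≤ k) {x : Fin (2 * k + 1) → ℝ} (hx : ∀ i, 0 < x i)
    (hmax : ∀ i, x i ≤ x (Fin.last _)) :
    distForm x (cycleGraph (2 * k + 1)).dist < distForm x (kiteGraph 3 (2 * k + 1)).dist := by
  let S : Finset (Fin (2 * k + 1)) := Finset.Icc ⟨2, by omega⟩ ⟨k, by omega⟩
  have hS : ∑ i ∈ S, x i ≤ (k - 1) * x (Fin.last _) := by
    have := Finset.sum_le_card_nsmul S x _ fun i _ => hmax i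
    have hcard : S.card = k - 1 := by simp [S]
    rwa [hcard, nsmul_eq_mul, Nat.cast_sub (by omega), Nat.cast_one] at this
  refine distForm_lt_of_shift hx (fun _ _ => dist_comm) (fun _ _ => dist_comm) {0}
    (fun i => (if i = Fin.last _ then (2 * (k - 1) : ℤ) else 0) - if i ∈ S then 1 else 0)
    (Set.singleton_nonempty 0) ?_ ?_ ?_ ?_
  · rintro _ rfl
    grind
  · rintro _ rfl b hb
    have := dist_cycleGraph_le 0 b
    simp only [kiteGraph_dist, Nat.dist, Fin.ext_iff, S, Finset.mem_Icc, Fin.le_def, Fin.val_last,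
      Set.mem_singleton_iff, Fin.val_zero] at this hb ⊢
    grind
  · intro a b hab
    have := dist_cycleGraph_le a b
    simp only [kiteGraph_dist, Nat.dist, Fin.ext_iff, Set.mem_singleton_iff, Fin.val_zero]
      at this hab ⊢
    grind
  · calc (0 : ℝ)
      _ < (k - 1) * x (Fin.last _) := by
        have : (2 : ℝ) ≤ k := by exact_mod_cast hk
        exact mul_pos (by linarith) (hx _)
      _ ≤ x (Fin.last _) * (2 * (k - 1)) - ∑ i ∈ S, x i := by linarith
      _ = _ := by
        simp [mul_sub, Finset.sum_sub_distrib]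

theorem cycleGraph_three_eq_kiteGraph : cycleGraph 3 = kiteGraph 3 3 := by
  rw [cycleGraph_three_eq_top]
  ext a b
  simp [kiteGraph]

theorem isKiteDominated_cycleGraph_dist {x : Fin n → ℝ} (hx : ∀ i, 0 < x i) (hn : 3 ≤ n)
    (hodd : Odd n) : IsKiteDominated n x (cycleGraph n).dist := by
  obtain ⟨k, rfl⟩ := hodd
  obtain ⟨i, -, hmax⟩ := Finset.exists_max_image Finset.univ x ⟨0, Finset.mem_univ 0⟩
  let rotate : cycleGraph (2 * k + 1) ≃g cycleGraph (2 * k + 1) :=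
    ⟨Equiv.addRight (i - Fin.last _), by simp [cycleGraph_adj']⟩
  refine .of_equiv rotate.toEquiv ⟨Equiv.refl _, ?_⟩
  simp only [RelIso.coe_fn_toEquiv, dist_map_iso, Equiv.refl_apply]
  obtain rfl | hk := (show 1 ≤ k by omega).eq_or_lt
  · exact Or.inl (congrArg SimpleGraph.dist cycleGraph_three_eq_kiteGraph)
  · exact Or.inr (distForm_cycleGraph_lt hk (fun _ => hx _) fun j => by
      simpa [rotate] using hmax (rotate j) (Finset.mem_univ _))

end OddCycle

section NonBipartite

variable {V W : Type*} {G : SimpleGraph V} {H : SimpleGraph W}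

-- Every closed walk cut off in forming the bypass is a cycle or traverses one edge back and forth.
theorem even_length_add_length_bypass [DecidableEq V]
    (h : ∀ (v : V) (c : G.Walk v v), c.IsCycle → Even c.length) {u v : V} (p : G.Walk u v) :
    Even (p.length + p.bypass.length) := by
  induction p with
  | nil => simp [Walk.bypass]
  | @cons u w v huw p ih =>
    by_cases hu : u ∈ p.bypass.support
    · let q := p.bypass.takeUntil u hu
      have hq : q.length ≠ 0 := fun hq => huw.ne' (Walk.eq_of_length_eq_zero hq)
      have hodd : Odd q.length := by
        by_contra heven
        rw [Nat.not_odd_iff_even] at heven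
        have hcycle : (Walk.cons huw q).IsCycle := by
          refine Walk.isCycle_iff_isPath_tail_and_le_length.mpr ⟨?_, ?_⟩
          · simpa using p.bypass_isPath.takeUntil hu
          · grind [Walk.length_cons]
        grind [h u _ hcycle, Walk.length_cons]
      have hsplit := congrArg Walk.length (p.bypass.take_spec hu)
      rw [Walk.length_append] at hsplit
      simp only [Walk.bypass, hu, dite_true, Walk.length_cons]
      grind
    · simp only [Walk.bypass, hu, dite_false, Walk.length_cons]
      grind

theorem exists_isCycle_odd_length (h : ¬G.IsBipartite) :
    ∃ (v : V) (c : G.Walk v v), c.IsCycle ∧ Odd c.length := by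
  classical
  contrapose! h
  refine two_colorable_iff_forall_loop_even.mpr fun u p => ?_
  have hbypass : p.bypass = .nil := (Walk.isPath_iff_nil.mp p.bypass_isPath).eq_nil
  simpa [hbypass] using even_length_add_length_bypass (by simpa using h) p

theorem exists_odd_cycleGraph_isContained (h : ¬G.IsBipartite) :
    ∃ n, 3 ≤ n ∧ Odd n ∧ cycleGraph n ⊑ G := by
  obtain ⟨v, c, hc, hodd⟩ := exists_isCycle_odd_length h
  exact ⟨c.length, hc.three_le_length, hodd,
    (cycleGraph_isContained_iff hc.three_le_length).mpr ⟨v, c, hc, rfl⟩⟩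

theorem not_isBipartite_cycleGraph {n : ℕ} (hn : 3 ≤ n) (hodd : Odd n) :
    ¬(cycleGraph n).IsBipartite := by
  rw [← chromaticNumber_le_two_iff_isBipartite,
    chromaticNumber_cycleGraph_of_odd n (by omega) hodd]
  norm_num

theorem three_le_card_of_not_isBipartite [Fintype V] (h : ¬G.IsBipartite) :
    3 ≤ Fintype.card V := by
  contrapose! h
  exact G.colorable_of_fintype.mono (Nat.le_of_lt_succ h)

-- A vertex outside the image that is farthest from the image of a given vertex can be deleted.
theorem exists_connected_induce_compl_singleton_of_not_surjective [Finite V] (hG : G.Connected)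
    (hH : H.Connected) {f : H →g G} (hf : ¬Function.Surjective f) :
    ∃ l, (G.induce {l}ᶜ).Connected ∧ Nonempty (H →g G.induce {l}ᶜ) := by
  classical
  obtain ⟨o⟩ := hH.nonempty
  obtain ⟨l, hl, hmax⟩ := Set.exists_max_image (Set.range f)ᶜ (G.dist · (f o)) (Set.toFinite _)
    (Set.nonempty_compl.mpr (mt Set.range_eq_univ.mp hf))
  let f' : H →g G.induce {l}ᶜ := ⟨fun w => ⟨f w, fun h => hl ⟨w, h⟩⟩, f.map_rel⟩
  refine ⟨l, (connected_iff_exists_forall_reachable _).mpr ⟨f' o, fun ⟨a, ha⟩ => ?_⟩, ⟨f'⟩⟩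
  by_cases haf : a ∈ Set.range f
  · obtain ⟨w, rfl⟩ := haf
    exact (hH o w).map f'
  · obtain ⟨p, hp⟩ := hG.exists_walk_length_eq_dist a (f o)
    have hlp : l ∉ p.support := fun hlp => by
      have hlt := Walk.length_dropUntil_lt_length hlp (Ne.symm ha)
      have := (dist_le _).trans_lt hlt
      exact (hmax a haf).not_gt (hp ▸ this)
    exact ⟨(p.induce {l}ᶜ fun w hw hwl => hlp (hwl ▸ hw)).reverse⟩

end NonBipartite

section Extremal

variable {V W : Type*} [Fintype V] {G : SimpleGraph V} {H : SimpleGraph W} {x : V → ℝ} {n : ℕ}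

theorem isKiteDominated_dist_of_bijective [Fintype W] (hx : ∀ v, 0 < x v) (hH : H.Connected)
    {f : H →g G} (hf : Function.Bijective f) (h : IsKiteDominated n (x ∘ f) H.dist) :
    IsKiteDominated n x G.dist :=
  .of_equiv (Equiv.ofBijective f hf)
    (h.mono (eq_or_distForm_lt_of_le (fun _ => hx _) (dist_map_le hH f)))

theorem isKiteDominated_dist_of_induce_compl {l : V} [Fintype ↥({l}ᶜ : Set V)]
    (hx : ∀ v, 0 < x v) (hn : 3 ≤ n) (hG : G.Connected) (hGl : (G.induce {l}ᶜ).Connected)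
    (h : ∀ y : ↥({l}ᶜ : Set V) → ℝ, (∀ v, 0 < y v) →
      IsKiteDominated n y (G.induce {l}ᶜ).dist) :
    IsKiteDominated (n + 1) x G.dist := by
  classical
  obtain ⟨v⟩ := hGl.nonempty
  have : Nontrivial V := ⟨v, l, v.2⟩
  obtain ⟨p, hp⟩ := hG.preconnected.exists_adj_of_nontrivial l
  let p' : ↥({l}ᶜ : Set V) := ⟨p, hp.ne'⟩
  let e : Option ↥({l}ᶜ : Set V) ≃ V := Equiv.optionSubtypeNe l
  have he : ∀ u, e u = u.elim l (Embedding.induce {l}ᶜ : G.induce {l}ᶜ ↪g G) := by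
    rintro (_ | _) <;> rfl
  have hsingle : 0 ≤ (Pi.single p' (x l) : ↥({l}ᶜ : Set V) → ℝ) := Pi.single_nonneg.mpr (hx l).le
  have hpendant : IsKiteDominated (n + 1) (x ∘ e) (pendantDist (G.induce {l}ᶜ).dist p') :=
    .pendant (fun _ => hx _) hn dist_self
      (h _ fun v => add_pos_of_pos_of_nonneg (hx v) (hsingle v))
  refine .of_equiv e (hpendant.mono (eq_or_distForm_lt_of_le (fun _ => hx _) fun u v => ?_))
  rw [he, he]
  exact dist_le_pendantDist hG hGl (Embedding.induce {l}ᶜ).toHom hp u v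

theorem isKiteDominated_dist (hG : G.Connected) (hb : ¬G.IsBipartite) (hx : ∀ v, 0 < x v) :
    IsKiteDominated (Fintype.card V) x G.dist := by
  classical
  induction hn : Fintype.card V generalizing V with
  | zero => exact absurd (three_le_card_of_not_isBipartite hb) (by omega)
  | succ n ih =>
    obtain ⟨N, hN, hodd, ⟨f⟩⟩ := exists_odd_cycleGraph_isContained hb
    have hcycle : (cycleGraph N).Connected := by
      obtain ⟨m, rfl⟩ := Nat.exists_eq_add_of_le' hN
      exact cycleGraph_connected
    by_cases hf : Function.Surjective f.toHom
    · have hNn : N = n + 1 := by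
        rw [← hn, ← Fintype.card_of_bijective ⟨f.injective, hf⟩, Fintype.card_fin]
      subst hNn
      exact isKiteDominated_dist_of_bijective hx hcycle ⟨f.injective, hf⟩
        (isKiteDominated_cycleGraph_dist (fun _ => hx _) hN hodd)
    · obtain ⟨l, hl, ⟨g⟩⟩ :=
          exists_connected_induce_compl_singleton_of_not_surjective hG hcycle hf
      have hbl : ¬(G.induce {l}ᶜ).IsBipartite := fun h =>
        not_isBipartite_cycleGraph hN hodd (h.of_hom g)
      have hcard : Fintype.card ↥({l}ᶜ : Set V) = n := by
        rw [Fintype.card_compl_set, hn, Set.card_singleton, Nat.add_sub_cancel]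
      exact isKiteDominated_dist_of_induce_compl hx
        (hcard ▸ three_le_card_of_not_isBipartite hbl) hG hl fun y hy => ih hl hbl hy hcard

end Extremal

theorem mainTheorem3_general (n : ℕ) (hn : 3 ≤ n) :
    IsConnectedChromatic 3 n (kiteGraph 3 n) ∧
    ∀ (V : Type*) [Fintype V] (G : SimpleGraph V), G.Connected → ¬G.IsBipartite →
      Fintype.card V = n →
      distSpectralRadius G ≤ distSpectralRadius (kiteGraph 3 n) ∧
      (distSpectralRadius G = distSpectralRadius (kiteGraph 3 n) ↔
        Nonempty (G ≃g kiteGraph 3 n)) := by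
  refine ⟨⟨kiteGraph_connected 3 (by omega), kiteGraph_chromaticNumber le_add_self hn,
    Fintype.card_fin n⟩, ?_⟩
  rintro V _ G hG hb rfl
  have : Nonempty (Fin (Fintype.card V)) := ⟨⟨0, by omega⟩⟩
  obtain ⟨x, hx, hxG⟩ := exists_pos_distForm_dist_eq hG
  obtain ⟨σ, hdist | hlt⟩ := isKiteDominated_dist hG hb hx
  · have hσ := congrFun₂ hdist
    have hρ := distSpectralRadius_eq_of_dist_eq σ hσ
    exact ⟨hρ.le, iff_of_true hρ (nonempty_iso_of_dist_eq σ hσ)⟩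
  · have hρ := distSpectralRadius_lt_of_distForm_lt σ hxG hlt
    exact ⟨hρ.le, iff_of_false hρ.ne fun ⟨e⟩ => hρ.ne <|
      distSpectralRadius_eq_of_dist_eq e.toEquiv fun u v => (dist_map_iso e u v).symm⟩

theorem mainTheorem3 (n : ℕ) (hn : 3 ≤ n) :
    IsConnectedChromatic 3 n (kiteGraph 3 n) ∧
    ∀ (V : Type*) [Fintype V] (G : SimpleGraph V), IsConnectedChromatic 3 n G →
      distSpectralRadius G ≤ distSpectralRadius (kiteGraph 3 n) ∧
      (distSpectralRadius G = distSpectralRadius (kiteGraph 3 n) ↔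
        Nonempty (G ≃g kiteGraph 3 n)) := by
  refine (mainTheorem3_general n hn).imp_right fun hmax V _ G h => hmax V G h.1 ?_ h.2.2
  norm_num [← chromaticNumber_le_two_iff_isBipartite, h.2.1]
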